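/- Let $X$ be a complex Banach space, $T$ a bounded linear operator on $X$, and $T^*$ its adjoint on the dual space $X^*$. Definitions. A bounded operator $S$ on a complex Banach space $Y$ has the single valued extension property (SVEP) if for every open $U\subseteq\mathbb{C}$ the only analytic function $f:U\to Y$ with $(S-zI)f(z)=0$ for all $z\in U$ is $f\equiv 0$. $S$ is semi-regular if its range $R(S)$ is closed and its null space satisfies $N(S)\subseteq\bigcap_{n\ge 0}R(S^n)$; it is quasinilpotent if its spectral radius is $0$. $S$ is pseudo-Fredholm (admits a generalized Kato decomposition) if $Y=M\oplus N$ for closed $S$-invariant subspaces $M,N$ such that $S|_M$ is semi-regular and $S|_N$ is quasinilpotent. $S$ is generalized Drazin invertible if $0$ is not an accumulation point of its spectrum $\sigma(S)$. Put $$\sigma_{gK}(T)=\{\lambda\in\mathbb{C}: T-\lambda I \text{ is not pseudo-Fredholm}\},\qquad \sigma_{gD}(T)=\{\lambda\in\mathbb{C}: T-\lambda I \text{ is not generalized Drazin invertible}\}.$$ $T$ is decomposable if for all open $U_1,U_2\subseteq\mathbb{C}$ with $U_1\cup U_2=\mathbb{C}$ there are closed $T$-invariant subspaces $X_1,X_2$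 of $X$ with $X_1+X_2=X$ and $\sigma(T|_{X_k})\subseteq U_k$ for $k=1,2$. Statement. If $T$ and $T^*$ both have the SVEP, then $\sigma_{gD}(T)=\sigma_{gK}(T)$. In particular, if $T$ is decomposable, then $\sigma_{gD}(T)=\sigma_{gK}(T)$. -/

import Mathlib

open Topology Filter

namespace BanachOp

variable {X : Type*} [NormedAddCommGroup X] [NormedSpace ℂ X]

/-- The Banach space adjoint `T* : X* → X*`, `φ ↦ φ ∘ T`, on the topological dual of `X`. -/
noncomputable def adj (T : X →L[ℂ] X) : StrongDual ℂ X →L[ℂ] StrongDual ℂ X :=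
  ContinuousLinearMap.precomp ℂ T

theorem adj_apply (T : X →L[ℂ] X) (φ : StrongDual ℂ X) (x : X) : adj T φ x = φ (T x) := rfl

/-- `T` has the single valued extension property (at every point `z₀` of the plane): for every
open neighbourhood `U` of `z₀`, the only analytic `f : U → X` with `(T - z) f(z) = 0` on `U` is
the zero function on `U`. -/
def HasSVEP (T : X →L[ℂ] X) : Prop :=
  ∀ z₀ : ℂ, ∀ U : Set ℂ, IsOpen U → z₀ ∈ U → ∀ f : ℂ → X, AnalyticOnNhd ℂ f U →
    (∀ z ∈ U, (T - z • ContinuousLinearMap.id ℂ X) (f z) = 0) → ∀ z ∈ U, f z = 0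

/-- `T` is semi-regular (a Kato operator): `R(T)` is closed and `N(T) ⊆ ⋂ n, R(T ^ n)`. -/
def IsSemiRegular (T : X →L[ℂ] X) : Prop :=
  IsClosed (Set.range T) ∧ ∀ x, T x = 0 → ∀ n : ℕ, x ∈ Set.range (T ^ n)

/-- `T` is quasinilpotent: its spectral radius is zero. -/
def IsQuasinilpotent (T : X →L[ℂ] X) : Prop :=
  spectralRadius ℂ T = 0

/-- `T` is pseudo-Fredholm, i.e. admits a generalized Kato decomposition: `X = M ⊕ N` with `M`, `N`
closed and `T`-invariant, `T|M` semi-regular and `T|N` quasinilpotent. -/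
def IsPseudoFredholm (T : X →L[ℂ] X) : Prop :=
  ∃ (M N : Submodule ℂ X) (hM : ∀ x ∈ M, T x ∈ M) (hN : ∀ x ∈ N, T x ∈ N),
    IsClosed (M : Set X) ∧ IsClosed (N : Set X) ∧ IsCompl M N ∧
      IsSemiRegular (T.restrict hM) ∧ IsQuasinilpotent (T.restrict hN)

/-- The generalized Kato (pseudo-Fredholm) spectrum of `T`. -/
def gKSpectrum (T : X →L[ℂ] X) : Set ℂ :=
  {z | ¬ IsPseudoFredholm (T - z • ContinuousLinearMap.id ℂ X)}

/-- `T` is generalized Drazin invertible: `0` is not an accumulation point of the spectrum. -/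
def IsGenDrazinInvertible (T : X →L[ℂ] X) : Prop :=
  ¬ AccPt (0 : ℂ) (𝓟 (spectrum ℂ T))

/-- The generalized Drazin spectrum of `T`. -/
def gDSpectrum (T : X →L[ℂ] X) : Set ℂ :=
  {z | ¬ IsGenDrazinInvertible (T - z • ContinuousLinearMap.id ℂ X)}

/-- `T` is decomposable: for every open cover `U₁ ∪ U₂` of the plane there are closed `T`-invariant
subspaces `X₁`, `X₂` with `X₁ + X₂ = X` and `σ(T|Xₖ) ⊆ Uₖ`. -/
def IsDecomposable (T : X →L[ℂ] X) : Prop :=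
  ∀ U₁ U₂ : Set ℂ, IsOpen U₁ → IsOpen U₂ → U₁ ∪ U₂ = Set.univ →
    ∃ (X₁ X₂ : Submodule ℂ X) (h₁ : ∀ x ∈ X₁, T x ∈ X₁) (h₂ : ∀ x ∈ X₂, T x ∈ X₂),
      IsClosed (X₁ : Set X) ∧ IsClosed (X₂ : Set X) ∧ X₁ ⊔ X₂ = ⊤ ∧
        spectrum ℂ (T.restrict h₁) ⊆ U₁ ∧ spectrum ℂ (T.restrict h₂) ⊆ U₂

end BanachOp

/-! One inclusion needs no SVEP: if `0` is not an accumulation point of the spectrum, the Riesz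
projection `p` at `0` splits `X` into `ker p`, where `T` is invertible and hence semi-regular, and
`range p`, where `T` is quasinilpotent (`exists_riesz_projection`).

For the converse, let `X = M ⊕ N` be a generalized Kato decomposition. On the closed-range part `M`,
a kernel vector lies in every `R(A ^ n)`, so it can be lifted repeatedly with norm control. The
lifts are coefficients of a power series of eigenvectors (`exists_analytic_of_lifting`), and SVEP of
`T` makes the kernel of `T|M` trivial. The same series in the dual, with SVEP of `T*`, makes `T|M`
surjective. So `T|M - z` is invertible for small `z`, while `T|N` has no nonzero spectrum.

A decomposable `T` has both SVEPs: an analytic eigenvector family is tested on the two pieces of a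
decomposition, and the identity theorem carries its vanishing from an annulus to the disc. -/

namespace BanachOp

/-! ### Power series of eigenvectors and the SVEP -/

section Basic

variable {Y : Type*} [NormedAddCommGroup Y] [NormedSpace ℂ Y]

theorem sub_smul_id_apply (S : Y →L[ℂ] Y) (z : ℂ) (x : Y) :
    (S - z • ContinuousLinearMap.id ℂ Y) x = S x - z • x := by
  simp

theorem notMem_spectrum_iff_bijective [CompleteSpace Y] (S : Y →L[ℂ] Y) (z : ℂ) :
    z ∉ spectrum ℂ S ↔ Function.Bijective (S - z • ContinuousLinearMap.id ℂ Y) := by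
  rw [spectrum.notMem_iff, ← ContinuousLinearMap.isUnit_iff_bijective, ← IsUnit.neg_iff, neg_sub]
  rfl

theorem isQuasinilpotent_iff [CompleteSpace Y] (S : Y →L[ℂ] Y) :
    IsQuasinilpotent S ↔ ∀ z ∈ spectrum ℂ S, z = 0 := by
  unfold IsQuasinilpotent spectralRadius
  simp

theorem adj_sub_smul_id (S : Y →L[ℂ] Y) (z : ℂ) :
    adj (S - z • ContinuousLinearMap.id ℂ Y) =
      adj S - z • ContinuousLinearMap.id ℂ (StrongDual ℂ Y) := by
  ext φ x
  simp [adj_apply]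

theorem HasSVEP.sub_smul_id {S : Y →L[ℂ] Y} (h : HasSVEP S) (w : ℂ) :
    HasSVEP (S - w • ContinuousLinearMap.id ℂ Y) := by
  intro z₀ U hU hz₀ f hf hSf z hz
  have key := h (z₀ + w) ((fun z => z - w) ⁻¹' U) (hU.preimage (by fun_prop)) (by simpa using hz₀)
    (fun z => f (z - w))
    (fun z hz => (hf (z - w) hz).comp (f := fun z => z - w)
      (analyticAt_id.sub analyticAt_const))
    (fun u hu => by
      have := hSf (u - w) hu
      simp only [sub_smul_id_apply] at this ⊢
      rw [← this]; module)
    (z + w) (by simpa using hz)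
  simpa using key

/-- Iterated lifting gives `S (y (n + 1)) = y n` with `‖y n‖ ≤ C ^ n * ‖x₀‖`, and `S - z` telescopes
on `∑ z ^ n • y n`. The predicate `p` confines the lifts to a set on which `S` can be lifted,
although `S` itself need not be onto. -/
theorem exists_analytic_of_lifting [CompleteSpace Y] (S : Y →L[ℂ] Y) (p : Y → Prop) {C : ℝ}
    (hC : 0 < C) (hp : ∀ y, p y → ∃ x, p x ∧ S x = y ∧ ‖x‖ ≤ C * ‖y‖)
    {x₀ : Y} (hpx : p x₀) (hx₀ : S x₀ = 0) :
    ∃ r > 0, ∃ f : ℂ → Y, AnalyticOnNhd ℂ f (Metric.ball 0 r) ∧ f 0 = x₀ ∧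
      ∀ z ∈ Metric.ball (0 : ℂ) r, (S - z • ContinuousLinearMap.id ℂ Y) (f z) = 0 := by
  choose! g hgp hgS hgC using hp
  set y : ℕ → Y := fun n => g^[n] x₀ with hy
  have hsucc : ∀ n, y (n + 1) = g (y n) := fun n => Function.iterate_succ_apply' g n x₀
  have hyp : ∀ n, p (y n) := by
    intro n
    induction n with
    | zero => exact hpx
    | succ n ih => rw [hsucc]; exact hgp _ ih
  have hyC : ∀ n, ‖y n‖ ≤ C ^ n * ‖x₀‖ := by
    intro n
    induction n with
    | zero => simp [hy]
    | succ n ih =>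
      rw [hsucc]
      refine (hgC _ (hyp n)).trans ?_
      rw [pow_succ', mul_assoc]
      gcongr
  -- The radius `1 / (2 * C)` makes the series geometric of ratio `1 / 2`.
  have hbound : ∀ n, ∀ z ∈ Metric.ball (0 : ℂ) (1 / (2 * C)),
      ‖z ^ n • y n‖ ≤ (1 / 2 : ℝ) ^ n * ‖x₀‖ := by
    intro n z hz
    rw [mem_ball_zero_iff] at hz
    rw [norm_smul, norm_pow]
    calc ‖z‖ ^ n * ‖y n‖ ≤ (1 / (2 * C)) ^ n * (C ^ n * ‖x₀‖) := by
          gcongr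
          exact hyC n
      _ = (1 / 2 : ℝ) ^ n * ‖x₀‖ := by
          rw [← mul_assoc, ← mul_pow]
          congr 2
          field_simp
  have hsum : Summable fun n : ℕ => (1 / 2 : ℝ) ^ n * ‖x₀‖ :=
    (summable_geometric_of_lt_one (by norm_num) (by norm_num)).mul_right _
  refine ⟨1 / (2 * C), by positivity, fun z => ∑' n, z ^ n • y n, ?_, ?_, ?_⟩
  · refine DifferentiableOn.analyticOnNhd ?_ Metric.isOpen_ball
    refine Complex.differentiableOn_tsum_of_summable_norm hsum (fun n => ?_) Metric.isOpen_ball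
      hbound
    fun_prop
  · change ∑' n, (0 : ℂ) ^ n • y n = x₀
    rw [tsum_eq_single 0 (fun n hn => by simp [hn])]
    simp [hy]
  · intro z hz
    have hs : Summable fun n => z ^ n • y n :=
      Summable.of_norm_bounded hsum (fun n => hbound n z hz)
    rw [sub_smul_id_apply, ContinuousLinearMap.map_tsum _ hs,
      (hs.mapL S).tsum_eq_zero_add, ← tsum_const_smul'' z]
    have h0 : S (z ^ 0 • y 0) = 0 := by simp [hy, hx₀]
    rw [h0, zero_add, sub_eq_zero]
    refine tsum_congr fun n => ?_
    rw [map_smul, hsucc, hgS _ (hyp n), smul_smul, pow_succ']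

theorem HasSVEP.eq_zero_of_lifting [CompleteSpace Y] {S : Y →L[ℂ] Y} (h : HasSVEP S)
    (p : Y → Prop) {C : ℝ} (hC : 0 < C) (hp : ∀ y, p y → ∃ x, p x ∧ S x = y ∧ ‖x‖ ≤ C * ‖y‖)
    {x₀ : Y} (hpx : p x₀) (hx₀ : S x₀ = 0) : x₀ = 0 := by
  obtain ⟨r, hr, f, hf, hf0, hSf⟩ := exists_analytic_of_lifting S p hC hp hpx hx₀
  have h0 : (0 : ℂ) ∈ Metric.ball (0 : ℂ) r := Metric.mem_ball_self hr
  rw [← hf0]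
  exact h 0 _ Metric.isOpen_ball h0 f hf hSf 0 h0

/-- A nonzero kernel vector would extend to an analytic family of eigenvectors, nonzero for all
small `z` by continuity. -/
theorem injective_of_surjective_of_accPt_resolvent [CompleteSpace Y] (S : Y →L[ℂ] Y)
    (hS : Function.Surjective S)
    (hfreq : ∃ᶠ z in 𝓝 (0 : ℂ),
      Function.Injective ((S - z • ContinuousLinearMap.id ℂ Y : Y →L[ℂ] Y))) :
    Function.Injective S := by
  rw [injective_iff_map_eq_zero]
  intro x hx
  obtain ⟨C, hC, hlift⟩ := S.exists_preimage_norm_le hS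
  obtain ⟨r, hr, f, hf, hf0, hSf⟩ := exists_analytic_of_lifting S (fun _ => True) hC
    (fun y _ => by simpa using hlift y) trivial hx
  have hev : ∀ᶠ z in 𝓝 (0 : ℂ), z ∈ Metric.ball (0 : ℂ) r := Metric.ball_mem_nhds 0 hr
  have hfz : ∃ᶠ z in 𝓝 (0 : ℂ), f z = 0 := by
    refine (hfreq.and_eventually hev).mono fun z hz => hz.1 ?_
    rw [hSf z hz.2, map_zero]
  rw [← hf0]
  by_contra hne
  exact hfz ((hf 0 (Metric.mem_ball_self hr)).continuousAt.eventually_ne hne)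

/-- Take a spectral point farthest from `c`. Points beyond it on the ray from `c` are in the
resolvent set, so surjectivity at the point upgrades to bijectivity. -/
theorem spectrum_subset_ball_of_surjective [CompleteSpace Y] (S : Y →L[ℂ] Y) (c : ℂ) {r : ℝ}
    (hr : 0 < r)
    (hS : ∀ z ∉ Metric.ball c r, Function.Surjective (S - z • ContinuousLinearMap.id ℂ Y)) :
    spectrum ℂ S ⊆ Metric.ball c r := by
  intro w hw
  by_contra hwr
  obtain ⟨z, hz, hmax⟩ := (spectrum.isCompact S).exists_isMaxOn ⟨w, hw⟩
    (f := fun z => dist z c) (by fun_prop)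
  have hzr : r ≤ dist z c := (not_lt.1 hwr).trans (hmax hw)
  have hzs := hS z (by simpa using hzr)
  have hinj := injective_of_surjective_of_accPt_resolvent _ hzs (by
    have ht : Tendsto (fun t : ℝ => (t : ℂ) * (z - c)) (𝓝[>] 0) (𝓝 0) := by
      have : Tendsto (fun t : ℝ => (t : ℂ) * (z - c)) (𝓝 0) (𝓝 (((0 : ℝ) : ℂ) * (z - c))) :=
        Continuous.tendsto (by fun_prop) 0
      simpa using this.mono_left nhdsWithin_le_nhds
    refine ht.frequently (Eventually.frequently ?_)
    filter_upwards [self_mem_nhdsWithin] with t htpos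
    rw [Set.mem_Ioi] at htpos
    have hnot : z + t * (z - c) ∉ spectrum ℂ S := by
      intro hmem
      have h1 : dist (z + t * (z - c)) c ≤ dist z c := hmax hmem
      have h2 : dist (z + t * (z - c)) c = (1 + t) * dist z c := by
        rw [dist_eq_norm, dist_eq_norm,
          show z + t * (z - c) - c = ((1 + t : ℝ) : ℂ) * (z - c) by push_cast; ring,
          norm_mul, Complex.norm_real, Real.norm_of_nonneg (by positivity)]
      nlinarith
    have hinj := ((notMem_spectrum_iff_bijective S _).1 hnot).1
    convert hinj using 2
    module)
  exact (notMem_spectrum_iff_bijective S z).2 ⟨hinj, hzs⟩ hz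

end Basic

/-! ### Decomposable operators: SVEP for `T` and for its adjoint -/

section Decomposable

variable {X : Type*} [NormedAddCommGroup X] [NormedSpace ℂ X]

theorem coe_restrict_sub_smul_id_apply (T : X →L[ℂ] X) {M : Submodule ℂ X} (hM : ∀ x ∈ M, T x ∈ M)
    (z : ℂ) (x : M) :
    (((T.restrict hM - z • ContinuousLinearMap.id ℂ M) x : M) : X) = T x - z • (x : X) := by
  simp

theorem exists_sub_smul_eq_of_notMem_spectrum_restrict [CompleteSpace X] {T : X →L[ℂ] X}
    {M : Submodule ℂ X} {hM : ∀ x ∈ M, T x ∈ M} (hc : IsClosed (M : Set X)) {z : ℂ}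
    (hz : z ∉ spectrum ℂ (T.restrict hM)) {y : X} (hy : y ∈ M) :
    ∃ x ∈ M, T x - z • x = y := by
  have : CompleteSpace M := hc.completeSpace_coe
  obtain ⟨x, hx⟩ := ((notMem_spectrum_iff_bijective _ z).1 hz).2 ⟨y, hy⟩
  refine ⟨x, x.2, ?_⟩
  rw [← coe_restrict_sub_smul_id_apply T hM, hx]

theorem eq_zero_of_notMem_spectrum_restrict [CompleteSpace X] {T : X →L[ℂ] X}
    {M : Submodule ℂ X} {hM : ∀ x ∈ M, T x ∈ M} (hc : IsClosed (M : Set X)) {z : ℂ}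
    (hz : z ∉ spectrum ℂ (T.restrict hM)) {x : X} (hx : x ∈ M) (h : T x - z • x = 0) : x = 0 := by
  have : CompleteSpace M := hc.completeSpace_coe
  have hinj := ((notMem_spectrum_iff_bijective _ z).1 hz).1
  have := (injective_iff_map_eq_zero _).1 hinj ⟨x, hx⟩
    (Subtype.ext (by rw [coe_restrict_sub_smul_id_apply]; exact h))
  simpa using congrArg Subtype.val this

theorem eq_zero_of_eq_zero_near_boundary {E : Type*} [NormedAddCommGroup E] [NormedSpace ℂ E]
    {g : ℂ → E} {c : ℂ} {r R : ℝ} (hr : 0 < r) (hrR : r < R)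
    (hg : AnalyticOnNhd ℂ g (Metric.ball c R))
    (h : ∀ z ∈ Metric.ball c R, r ≤ dist z c → g z = 0) : ∀ z ∈ Metric.ball c R, g z = 0 := by
  set w : ℂ := c + ((r + R) / 2 : ℝ) with hw
  have hwc : dist w c = (r + R) / 2 := by
    rw [hw, dist_self_add_left, Complex.norm_real, Real.norm_of_nonneg (by linarith)]
  have hwR : w ∈ Metric.ball c R := by rw [Metric.mem_ball, hwc]; linarith
  refine hg.eqOn_zero_of_preconnected_of_eventuallyEq_zero (convex_ball c R).isPreconnected hwR ?_
  have hopen : IsOpen {z : ℂ | r < dist z c} := isOpen_lt continuous_const (by fun_prop)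
  have hwr : r < dist w c := by rw [hwc]; linarith
  filter_upwards [Metric.isOpen_ball.mem_nhds hwR, hopen.mem_nhds hwr] with z hz hz'
    using h z hz (le_of_lt hz')

theorem IsDecomposable.exists_disc_decomposition {T : X →L[ℂ] X} (hT : IsDecomposable T)
    (c : ℂ) {r : ℝ} (hr : 0 < r) :
    ∃ (X₁ X₂ : Submodule ℂ X) (h₁ : ∀ x ∈ X₁, T x ∈ X₁) (h₂ : ∀ x ∈ X₂, T x ∈ X₂),
      IsClosed (X₁ : Set X) ∧ IsClosed (X₂ : Set X) ∧ X₁ ⊔ X₂ = ⊤ ∧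
        (∀ z, dist z c ≤ r → z ∉ spectrum ℂ (T.restrict h₁)) ∧
        (∀ z, 2 * r ≤ dist z c → z ∉ spectrum ℂ (T.restrict h₂)) := by
  obtain ⟨X₁, X₂, h₁, h₂, hc₁, hc₂, hsup, hs₁, hs₂⟩ :=
    hT (Metric.closedBall c r)ᶜ (Metric.ball c (2 * r)) Metric.isClosed_closedBall.isOpen_compl
      Metric.isOpen_ball (by
        ext z
        simp only [Set.mem_union, Set.mem_compl_iff, Metric.mem_closedBall, Metric.mem_ball,
          Set.mem_univ, iff_true, not_le]
        rcases lt_or_ge r (dist z c) with h | h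
        · exact Or.inl h
        · exact Or.inr (by linarith))
  exact ⟨X₁, X₂, h₁, h₂, hc₁, hc₂, hsup, fun z hz hmem => hs₁ hmem hz,
    fun z hz hmem => hz.not_gt (hs₂ hmem)⟩

theorem exists_ball_three_mul_subset {U : Set ℂ} (hU : IsOpen U) {c : ℂ} (hc : c ∈ U) :
    ∃ r > 0, Metric.ball c (3 * r) ⊆ U := by
  obtain ⟨ε, hε, h⟩ := Metric.isOpen_iff.1 hU c hc
  exact ⟨ε / 3, by positivity, by rwa [mul_div_cancel₀ _ (by norm_num)]⟩

theorem adj_eigenvector_apply_eq_zero {T : X →L[ℂ] X} {φ : StrongDual ℂ X} {z : ℂ}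
    (h : (adj T - z • ContinuousLinearMap.id ℂ (StrongDual ℂ X)) φ = 0) (x : X) :
    φ (T x - z • x) = 0 := by
  have := DFunLike.congr_fun h x
  simpa [adj_apply] using this

/-- The functional `f z` annihilates the range of `T - z`. This range contains `X₁` at `z = c`, and
contains `X₂` on the annulus `2r ≤ |z - c| < 3r`, from which vanishing spreads to `c`. -/
theorem IsDecomposable.hasSVEP_adj [CompleteSpace X] {T : X →L[ℂ] X} (hT : IsDecomposable T) :
    HasSVEP (adj T) := by
  rintro - U hU - f hf hTf c hc
  obtain ⟨r, hr, hrU⟩ := exists_ball_three_mul_subset hU hc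
  obtain ⟨X₁, X₂, h₁, h₂, hc₁, hc₂, hsup, hs₁, hs₂⟩ := hT.exists_disc_decomposition c hr
  have hfx : ∀ x, AnalyticOnNhd ℂ (fun z => f z x) (Metric.ball c (3 * r)) := fun x =>
    (ContinuousLinearMap.apply ℂ ℂ x).comp_analyticOnNhd (hf.mono hrU)
  have hcb : c ∈ Metric.ball c (3 * r) := Metric.mem_ball_self (by positivity)
  ext x
  obtain ⟨x₁, hx₁, x₂, hx₂, rfl⟩ := Submodule.mem_sup.1 (hsup.symm ▸ Submodule.mem_top : x ∈ X₁ ⊔ X₂)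
  have e₁ : f c x₁ = 0 := by
    obtain ⟨y, -, hy⟩ :=
      exists_sub_smul_eq_of_notMem_spectrum_restrict hc₁ (hs₁ c (by simp [hr.le])) hx₁
    rw [← hy]
    exact adj_eigenvector_apply_eq_zero (hTf c hc) y
  have e₂ : f c x₂ = 0 := by
    refine eq_zero_of_eq_zero_near_boundary (r := 2 * r) (by positivity) (by linarith) (hfx x₂)
      (fun z hz hzr => ?_) c hcb
    obtain ⟨y, -, hy⟩ := exists_sub_smul_eq_of_notMem_spectrum_restrict hc₂ (hs₂ z hzr) hx₂
    rw [← hy]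
    exact adj_eigenvector_apply_eq_zero (hTf z (hrU hz)) y
  simp [e₁, e₂]

/-- The operator induced by `T` on the quotient by an invariant subspace. -/
def quotientMap (T : X →L[ℂ] X) (M : Submodule ℂ X) (hM : ∀ x ∈ M, T x ∈ M) :
    X ⧸ M →L[ℂ] X ⧸ M :=
  M.liftQL (M.mkQL.comp T) (fun x hx => by simpa using hM x hx)

theorem quotientMap_mk (T : X →L[ℂ] X) (M : Submodule ℂ X) (hM : ∀ x ∈ M, T x ∈ M) (x : X) :
    quotientMap T M hM (M.mkQL x) = M.mkQL (T x) := rfl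

/-- Modulo `X₁` every vector comes from `X₂`, so the induced operator has spectrum in the disc of
radius `2r`. Hence `f` vanishes modulo `X₁`, first on the annulus and then at `c`, where `T - c` is
injective on `X₁`. -/
theorem IsDecomposable.hasSVEP [CompleteSpace X] {T : X →L[ℂ] X} (hT : IsDecomposable T) :
    HasSVEP T := by
  rintro - U hU - f hf hTf c hc
  obtain ⟨r, hr, hrU⟩ := exists_ball_three_mul_subset hU hc
  obtain ⟨X₁, X₂, h₁, h₂, hc₁, hc₂, hsup, hs₁, hs₂⟩ := hT.exists_disc_decomposition c hr
  have hcb : c ∈ Metric.ball c (3 * r) := Metric.mem_ball_self (by positivity)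
  have hTf' : ∀ z ∈ U, T (f z) - z • f z = 0 := fun z hz => by
    rw [← sub_smul_id_apply, hTf z hz]
  have := hc₁
  have hspec : spectrum ℂ (quotientMap T X₁ h₁) ⊆ Metric.ball c (2 * r) := by
    refine spectrum_subset_ball_of_surjective _ c (by positivity) fun z hz q => ?_
    obtain ⟨x, rfl⟩ := Submodule.mkQ_surjective _ q
    obtain ⟨x₁, hx₁, x₂, hx₂, rfl⟩ :=
      Submodule.mem_sup.1 (hsup.symm ▸ Submodule.mem_top : x ∈ X₁ ⊔ X₂)
    obtain ⟨y, -, hy⟩ := exists_sub_smul_eq_of_notMem_spectrum_restrict hc₂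
      (hs₂ z (by simpa using hz)) hx₂
    refine ⟨X₁.mkQL y, ?_⟩
    rw [sub_smul_id_apply, quotientMap_mk, ← map_smul, ← map_sub, hy]
    simpa using hx₁
  have hq : ∀ z ∈ Metric.ball c (3 * r), X₁.mkQL (f z) = 0 := by
    refine eq_zero_of_eq_zero_near_boundary (r := 2 * r) (by positivity) (by linarith)
      (X₁.mkQL.comp_analyticOnNhd (hf.mono hrU)) fun z hz hzr => ?_
    have hz' : z ∉ spectrum ℂ (quotientMap T X₁ h₁) := fun h => hzr.not_gt (hspec h)
    refine (injective_iff_map_eq_zero _).1 ((notMem_spectrum_iff_bijective _ z).1 hz').1 _ ?_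
    rw [sub_smul_id_apply, quotientMap_mk, ← map_smul, ← map_sub,
      hTf' z (hrU hz), map_zero]
  exact eq_zero_of_notMem_spectrum_restrict hc₁ (hs₁ c (by simp [hr.le]))
    (by simpa using hq c hcb) (hTf' c hc)

end Decomposable

/-! ### From a generalized Kato decomposition to an isolated spectral point -/

section PseudoFredholm

variable {X : Type*} [NormedAddCommGroup X] [NormedSpace ℂ X]

theorem exists_preimage_norm_le_of_isClosed_range [CompleteSpace X] {A : X →L[ℂ] X}
    (hA : IsClosed (Set.range A)) : ∃ C > 0, ∀ x, ∃ x', A x' = A x ∧ ‖x'‖ ≤ C * ‖A x‖ := by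
  have : CompleteSpace A.range := IsClosed.completeSpace_coe (hs := hA)
  obtain ⟨C, hC, h⟩ := (A.codRestrict A.range fun x => ⟨x, rfl⟩).exists_preimage_norm_le
    (by rintro ⟨_, x, rfl⟩; exact ⟨x, rfl⟩)
  refine ⟨C, hC, fun x => ?_⟩
  obtain ⟨x', hx', hn⟩ := h ⟨A x, x, rfl⟩
  exact ⟨x', congrArg Subtype.val hx', hn⟩

/-- This keeps any lift of a vector of `⋂ n, R(A ^ n)` inside that intersection, so lifts may be
chosen for their norm alone. -/
theorem IsSemiRegular.mem_range_pow_of_apply {A : X →L[ℂ] X} (hA : IsSemiRegular A) {x : X}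
    (h : ∀ n : ℕ, A x ∈ Set.range (A ^ n)) (n : ℕ) : x ∈ Set.range (A ^ n) := by
  obtain ⟨u, hu⟩ := h (n + 1)
  have hker : A (x - (A ^ n) u) = 0 := by
    rw [map_sub, sub_eq_zero, ← hu, pow_succ', mul_apply_eq_comp]
  obtain ⟨v, hv⟩ := hA.2 _ hker n
  exact ⟨v + u, by rw [map_add, hv, sub_add_cancel]⟩

theorem HasSVEP.injective_restrict_of_isSemiRegular [CompleteSpace X] {T : X →L[ℂ] X}
    (hT : HasSVEP T) {M : Submodule ℂ X} (hM : ∀ x ∈ M, T x ∈ M) (hc : IsClosed (M : Set X))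
    (hs : IsSemiRegular (T.restrict hM)) : Function.Injective (T.restrict hM) := by
  have : CompleteSpace M := hc.completeSpace_coe
  rw [injective_iff_map_eq_zero]
  intro x hx
  obtain ⟨C, hC, hlift⟩ := exists_preimage_norm_le_of_isClosed_range hs.1
  refine Subtype.ext (hT.eq_zero_of_lifting
    (fun y => ∃ m : M, (m : X) = y ∧ ∀ n : ℕ, m ∈ Set.range (T.restrict hM ^ n)) hC ?_
    ⟨x, rfl, hs.2 x hx⟩ (congrArg Subtype.val hx))
  rintro _ ⟨m, rfl, hm⟩
  obtain ⟨u, hu⟩ := hm 1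
  rw [pow_one] at hu
  obtain ⟨v, hv, hvn⟩ := hlift u
  rw [hu] at hv hvn
  exact ⟨v, ⟨v, rfl, hs.mem_range_pow_of_apply (by rwa [hv])⟩, congrArg Subtype.val hv, hvn⟩

/-- Hahn–Banach on the quotient by the closed range. -/
theorem surjective_of_isClosed_range_of_forall_dual [CompleteSpace X] {A : X →L[ℂ] X}
    (hA : IsClosed (Set.range A)) (h : ∀ φ : StrongDual ℂ X, φ.comp A = 0 → φ = 0) :
    Function.Surjective A := by
  intro x
  have hc : IsClosed (A.range : Set X) := hA
  by_contra hx
  have hne : ‖A.range.mkQL x‖ ≠ 0 := by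
    rw [norm_ne_zero_iff]
    intro h0
    exact hx (by simpa using h0)
  obtain ⟨g, -, hg⟩ := exists_dual_vector ℂ (A.range.mkQL x) hne
  have h0 : g.comp A.range.mkQL = 0 := h _ (by
    ext y
    have : A.range.mkQ (A y) = 0 := by simp
    simp [this])
  have h1 : g (A.range.mkQL x) = 0 := DFunLike.congr_fun h0 x
  rw [hg] at h1
  exact hne (Complex.ofReal_eq_zero.1 h1)

theorem exists_dual_comp_eq [CompleteSpace X] {A : X →L[ℂ] X}
    (hA : IsClosed (Set.range A)) (hinj : Function.Injective A) :
    ∃ C > 0, ∀ φ : StrongDual ℂ X, ∃ ψ : StrongDual ℂ X, ψ.comp A = φ ∧ ‖ψ‖ ≤ C * ‖φ‖ := by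
  set e := A.equivRange hinj hA
  refine ⟨‖(e.symm : A.range →L[ℂ] X)‖ + 1, by positivity, fun φ => ?_⟩
  obtain ⟨ψ, hψ, hn⟩ := exists_extension_norm_eq A.range
    (φ.comp (e.symm : A.range →L[ℂ] X))
  refine ⟨ψ, ?_, ?_⟩
  · ext x
    exact (hψ (e x)).trans (congrArg φ (e.symm_apply_apply x))
  · rw [hn]
    refine (ContinuousLinearMap.opNorm_comp_le _ _).trans ?_
    rw [mul_comm]
    gcongr
    linarith

/-- The dual of `M` embeds in that of `X` by `φ ↦ φ ∘ P`, with `P` the projection onto `M` along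
`N`. This intertwines the adjoints of `T|M` and `T`, so the lifting argument runs inside `X*` and
kills every functional vanishing on `R(T|M)`. -/
theorem HasSVEP.surjective_restrict_of_adj [CompleteSpace X] {T : X →L[ℂ] X}
    (hT : HasSVEP (adj T)) {M N : Submodule ℂ X} (hM : ∀ x ∈ M, T x ∈ M) (hN : ∀ x ∈ N, T x ∈ N)
    (hMc : IsClosed (M : Set X)) (hNc : IsClosed (N : Set X)) (hMN : IsCompl M N)
    (hcl : IsClosed (Set.range (T.restrict hM))) (hinj : Function.Injective (T.restrict hM)) :
    Function.Surjective (T.restrict hM) := by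
  have : CompleteSpace M := hMc.completeSpace_coe
  have htop := Submodule.IsCompl.isTopCompl_of_isClosed hMN hMc hNc
  set P : X →L[ℂ] M := M.projectionOntoL N htop with hP
  have hPM : ∀ m : M, P m = m := M.projectionOntoL_apply_left htop
  have hPN : ∀ n ∈ N, P n = 0 := fun n hn => (M.projectionOntoL_apply_eq_zero_iff htop).2 hn
  have hPT : ∀ x, P (T x) = T.restrict hM (P x) := by
    intro x
    obtain ⟨m, hm, n, hn, rfl⟩ :=
      Submodule.mem_sup.1 (hMN.sup_eq_top.symm ▸ Submodule.mem_top : x ∈ M ⊔ N)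
    have h1 : P (T m) = T.restrict hM ⟨m, hm⟩ := hPM ⟨T m, hM m hm⟩
    have h2 : P m = ⟨m, hm⟩ := hPM ⟨m, hm⟩
    rw [map_add, map_add, map_add, hPN n hn, hPN _ (hN n hn), h1, h2, add_zero, add_zero]
  have hadj : ∀ φ : StrongDual ℂ M, adj T (φ.comp P) = (φ.comp (T.restrict hM)).comp P := by
    intro φ
    ext x
    simp [adj_apply, hPT]
  have hnorm : ∀ φ : StrongDual ℂ M, ‖φ‖ ≤ ‖φ.comp P‖ := by
    intro φ
    refine ContinuousLinearMap.opNorm_le_bound _ (norm_nonneg _) fun m => ?_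
    have := (φ.comp P).le_opNorm m
    rwa [ContinuousLinearMap.comp_apply, hPM] at this
  obtain ⟨C, hC, hlift⟩ := exists_dual_comp_eq hcl hinj
  refine surjective_of_isClosed_range_of_forall_dual hcl fun φ hφ => ?_
  have hzero : φ.comp P = 0 := by
    refine hT.eq_zero_of_lifting (fun ψ => ∃ φ : StrongDual ℂ M, φ.comp P = ψ)
      -- The `+ 1` keeps the constant positive even if `P = 0`.
      (C := C * (‖P‖ + 1)) (by positivity) ?_ ⟨φ, rfl⟩ ?_
    · rintro _ ⟨χ, rfl⟩
      obtain ⟨ψ, hψ, hn⟩ := hlift χ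
      refine ⟨ψ.comp P, ⟨ψ, rfl⟩, by rw [hadj, hψ], ?_⟩
      calc ‖ψ.comp P‖ ≤ ‖ψ‖ * ‖P‖ := ContinuousLinearMap.opNorm_comp_le _ _
        _ ≤ (C * ‖χ‖) * (‖P‖ + 1) := by gcongr; linarith
        _ ≤ (C * ‖χ.comp P‖) * (‖P‖ + 1) := by gcongr; exact hnorm χ
        _ = C * (‖P‖ + 1) * ‖χ.comp P‖ := by ring
    · rw [hadj, hφ, ContinuousLinearMap.zero_comp]
  exact norm_le_zero_iff.1 ((hnorm φ).trans (by rw [hzero, norm_zero]))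

theorem bijective_of_isCompl_restrict {T : X →L[ℂ] X} {M N : Submodule ℂ X}
    (hM : ∀ x ∈ M, T x ∈ M) (hN : ∀ x ∈ N, T x ∈ N) (hMN : IsCompl M N) (z : ℂ)
    (hbM : Function.Bijective (T.restrict hM - z • ContinuousLinearMap.id ℂ M))
    (hbN : Function.Bijective (T.restrict hN - z • ContinuousLinearMap.id ℂ N)) :
    Function.Bijective (T - z • ContinuousLinearMap.id ℂ X) := by
  constructor
  · rw [injective_iff_map_eq_zero]
    intro x hx
    obtain ⟨m, hm, n, hn, rfl⟩ :=
      Submodule.mem_sup.1 (hMN.sup_eq_top.symm ▸ Submodule.mem_top : x ∈ M ⊔ N)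
    rw [map_add, sub_smul_id_apply, sub_smul_id_apply] at hx
    have hmM : T m - z • m ∈ M := M.sub_mem (hM m hm) (M.smul_mem z hm)
    have hnN : T n - z • n ∈ N := N.sub_mem (hN n hn) (N.smul_mem z hn)
    have hm0 : T m - z • m = 0 := Submodule.disjoint_def.1 hMN.disjoint _ hmM (by
      rw [eq_neg_of_add_eq_zero_left hx]
      exact N.neg_mem hnN)
    rw [hm0, zero_add] at hx
    have h1 := (injective_iff_map_eq_zero _).1 hbM.1 ⟨m, hm⟩
      (Subtype.ext (by rw [coe_restrict_sub_smul_id_apply]; exact hm0))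
    have h2 := (injective_iff_map_eq_zero _).1 hbN.1 ⟨n, hn⟩
      (Subtype.ext (by rw [coe_restrict_sub_smul_id_apply]; exact hx))
    rw [Submodule.mk_eq_zero] at h1 h2
    rw [h1, h2, add_zero]
  · intro y
    obtain ⟨m, hm, n, hn, rfl⟩ :=
      Submodule.mem_sup.1 (hMN.sup_eq_top.symm ▸ Submodule.mem_top : y ∈ M ⊔ N)
    obtain ⟨u, hu⟩ := hbM.2 ⟨m, hm⟩
    obtain ⟨v, hv⟩ := hbN.2 ⟨n, hn⟩
    refine ⟨u + v, ?_⟩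
    rw [map_add, sub_smul_id_apply, sub_smul_id_apply, ← coe_restrict_sub_smul_id_apply T hM, hu,
      ← coe_restrict_sub_smul_id_apply T hN, hv]

theorem isGenDrazinInvertible_iff_eventually (T : X →L[ℂ] X) :
    IsGenDrazinInvertible T ↔ ∀ᶠ z in 𝓝 (0 : ℂ), z ≠ 0 → z ∉ spectrum ℂ T := by
  unfold IsGenDrazinInvertible
  rw [accPt_iff_frequently, not_frequently]
  simp only [not_and]

theorem notMem_spectrum_of_isCompl_restrict [CompleteSpace X] {T : X →L[ℂ] X}
    {M N : Submodule ℂ X} (hM : ∀ x ∈ M, T x ∈ M) (hN : ∀ x ∈ N, T x ∈ N)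
    (hMc : IsClosed (M : Set X)) (hNc : IsClosed (N : Set X)) (hMN : IsCompl M N) {z : ℂ}
    (hzM : z ∉ spectrum ℂ (T.restrict hM)) (hzN : z ∉ spectrum ℂ (T.restrict hN)) :
    z ∉ spectrum ℂ T := by
  have := hMc.completeSpace_coe
  have := hNc.completeSpace_coe
  rw [notMem_spectrum_iff_bijective] at hzM hzN ⊢
  exact bijective_of_isCompl_restrict hM hN hMN z hzM hzN

theorem eventually_notMem_spectrum_of_bijective [CompleteSpace X] {A : X →L[ℂ] X}
    (hA : Function.Bijective A) : ∀ᶠ z in 𝓝 (0 : ℂ), z ∉ spectrum ℂ A := by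
  refine (spectrum.isClosed A).isOpen_compl.mem_nhds ?_
  rw [Set.mem_compl_iff, notMem_spectrum_iff_bijective, zero_smul, sub_zero]
  exact hA

theorem IsPseudoFredholm.isGenDrazinInvertible [CompleteSpace X] {T : X →L[ℂ] X}
    (h : IsPseudoFredholm T) (hT : HasSVEP T) (hT' : HasSVEP (adj T)) :
    IsGenDrazinInvertible T := by
  obtain ⟨M, N, hM, hN, hMc, hNc, hMN, hs, hq⟩ := h
  have : CompleteSpace M := hMc.completeSpace_coe
  have : CompleteSpace N := hNc.completeSpace_coe
  have hinj := hT.injective_restrict_of_isSemiRegular hM hMc hs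
  have hsurj := hT'.surjective_restrict_of_adj hM hN hMc hNc hMN hs.1 hinj
  rw [isQuasinilpotent_iff] at hq
  rw [isGenDrazinInvertible_iff_eventually]
  filter_upwards [eventually_notMem_spectrum_of_bijective ⟨hinj, hsurj⟩] with z hz hz0
  exact notMem_spectrum_of_isCompl_restrict hM hN hMc hNc hMN hz fun hmem => hz0 (hq z hmem)

end PseudoFredholm

/-! ### The Riesz projection at an isolated spectral point -/

section RieszProjection

open Real Complex in
-- Integrates `(z - w)⁻¹ * z = 1 + w * (z - w)⁻¹`. It is used with `f` the resolvent and `L` left or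
-- right multiplication by `a`.
theorem two_pi_I_inv_smul_circleIntegral_kernel {E : Type*} [NormedAddCommGroup E]
    [NormedSpace ℂ E] [CompleteSpace E] {ρ : ℝ} (hρ : 0 < ρ) {f : ℂ → E}
    (hf : ContinuousOn f (Metric.sphere 0 ρ)) (L : E →L[ℂ] E) (e : E)
    (hL : ∀ z ∈ Metric.sphere (0 : ℂ) ρ, L (f z) = z • f z - e) {w : ℂ} (hw : ‖w‖ ≠ ρ) :
    L ((2 * π * I : ℂ)⁻¹ • ∮ z in C(0, ρ), (z - w)⁻¹ • f z) =
      ((2 * π * I : ℂ)⁻¹ • ∮ z in C(0, ρ), f z) +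
      w • ((2 * π * I : ℂ)⁻¹ • ∮ z in C(0, ρ), (z - w)⁻¹ • f z) -
      ((2 * π * I : ℂ)⁻¹ * ∮ z in C(0, ρ), (z - w)⁻¹) • e := by
  have hne : ∀ z ∈ Metric.sphere (0 : ℂ) ρ, z - w ≠ 0 := by
    intro z hz h
    rw [sub_eq_zero] at h
    rw [mem_sphere_zero_iff_norm, h] at hz
    exact hw hz
  have hk : ContinuousOn (fun z : ℂ => (z - w)⁻¹) (Metric.sphere 0 ρ) :=
    ContinuousOn.inv₀ (by fun_prop) hne
  have hkf : ContinuousOn (fun z : ℂ => (z - w)⁻¹ • f z) (Metric.sphere 0 ρ) := hk.smul hf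
  have hcomm : L (∮ z in C(0, ρ), (z - w)⁻¹ • f z) = ∮ z in C(0, ρ), L ((z - w)⁻¹ • f z) := by
    have hint := (hkf.circleIntegrable hρ.le).out
    unfold circleIntegral
    rw [← ContinuousLinearMap.intervalIntegral_comp_comm L hint]
    simp only [map_smul]
  have hcongr : (∮ z in C(0, ρ), L ((z - w)⁻¹ • f z)) =
      ∮ z in C(0, ρ), (f z + w • ((z - w)⁻¹ • f z)) - (z - w)⁻¹ • e := by
    refine circleIntegral.integral_congr hρ.le fun z hz => ?_
    have h1 : (z - w)⁻¹ * z = 1 + w * (z - w)⁻¹ := by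
      have := hne z hz
      field_simp
      ring
    rw [map_smul, hL z hz, smul_sub, smul_smul, h1, add_smul, one_smul, smul_smul]
  have hi1 : CircleIntegrable f 0 ρ := hf.circleIntegrable hρ.le
  have hi2 : CircleIntegrable (fun z => w • ((z - w)⁻¹ • f z)) 0 ρ :=
    (hkf.const_smul w).circleIntegrable hρ.le
  have hi3 : CircleIntegrable (fun z => (z - w)⁻¹ • e) 0 ρ :=
    (hk.smul continuousOn_const).circleIntegrable hρ.le
  have hi12 : CircleIntegrable (fun z => f z + w • ((z - w)⁻¹ • f z)) 0 ρ := hi1.add hi2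
  rw [map_smul, hcomm, hcongr, circleIntegral.integral_sub hi12 hi3,
    circleIntegral.integral_add hi1 hi2, circleIntegral.integral_smul,
    circleIntegral.integral_smul_const]
  module

open Real Complex in
theorem differentiableOn_cauchy_integral {E : Type*} [NormedAddCommGroup E] [NormedSpace ℂ E]
    [CompleteSpace E] {ρ : ℝ} (hρ : 0 < ρ) {f : ℂ → E} (hf : CircleIntegrable f 0 ρ) :
    DifferentiableOn ℂ (fun w => (2 * π * I : ℂ)⁻¹ • ∮ z in C(0, ρ), (z - w)⁻¹ • f z)
      (Metric.ball 0 ρ) := by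
  lift ρ to NNReal using hρ.le
  have h := (hasFPowerSeriesOn_cauchy_integral hf (by exact_mod_cast hρ)).differentiableOn
  rwa [Metric.eball_coe] at h

theorem circleIntegral_sub_inv_eq_zero {ρ : ℝ} (hρ : 0 < ρ) {w : ℂ} (hw : ρ < ‖w‖) :
    (∮ z in C(0, ρ), (z - w)⁻¹) = 0 := by
  refine DiffContOnCl.circleIntegral_eq_zero hρ.le ?_
  refine DifferentiableOn.diffContOnCl ?_
  rw [closure_ball _ hρ.ne']
  refine DifferentiableOn.inv (by fun_prop) fun z hz h => ?_
  rw [mem_closedBall_zero_iff, sub_eq_zero.1 h] at hz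
  exact hw.not_ge hz

variable {A : Type*} [NormedRing A] [NormedAlgebra ℂ A]

theorem mul_resolvent_eq {a : A} {z : ℂ} (hz : z ∈ resolventSet ℂ a) :
    a * resolvent a z = z • resolvent a z - 1 := by
  have h : (algebraMap ℂ A z - a) * resolvent a z = 1 := Ring.mul_inverse_cancel _ hz
  rw [sub_mul, ← Algebra.smul_def] at h
  rw [← h]
  abel

theorem resolvent_mul_eq {a : A} {z : ℂ} (hz : z ∈ resolventSet ℂ a) :
    resolvent a z * a = z • resolvent a z - 1 := by
  have h : resolvent a z * (algebraMap ℂ A z - a) = 1 := Ring.inverse_mul_cancel _ hz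
  rw [mul_sub, ← Algebra.commutes, ← Algebra.smul_def] at h
  rw [← h]
  abel

open Real Complex in
/-- The Riesz projection of an element whose spectrum meets a punctured disc around `0` trivially,
together with an inverse of `a` modulo it and inverses of `z - a` on it. -/
theorem exists_riesz_projection [CompleteSpace A] (a : A) {r : ℝ} (hr : 0 < r)
    (ha : ∀ z : ℂ, z ≠ 0 → ‖z‖ < r → z ∈ resolventSet ℂ a) :
    ∃ p g : A, p * p = p ∧ a * p = p * a ∧ a * g = 1 - p ∧ g * a = 1 - p ∧
      ∀ z : ℂ, z ≠ 0 → ∃ h : A, (a - z • 1) * h = p ∧ h * (a - z • 1) = p := by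
  set R : ℂ → A := resolvent a with hRdef
  set ρ : ℝ := r / 2 with hρdef
  have hρ : 0 < ρ := by positivity
  have hρr : ρ < r := by linarith
  have hdiff : ∀ z : ℂ, z ≠ 0 → ‖z‖ < r → DifferentiableAt ℂ R z := fun z h0 h =>
    (spectrum.hasDerivAt_resolvent_const_left (ha z h0 h)).differentiableAt
  have hsph : ∀ s : ℝ, 0 < s → s < r → ∀ z ∈ Metric.sphere (0 : ℂ) s, z ∈ resolventSet ℂ a := by
    intro s hs hsr z hz
    rw [mem_sphere_zero_iff_norm] at hz
    exact ha z (norm_pos_iff.1 (hz ▸ hs)) (hz ▸ hsr)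
  have hcont : ∀ s : ℝ, 0 < s → s < r → ContinuousOn R (Metric.sphere 0 s) := by
    intro s hs hsr z hz
    rw [mem_sphere_zero_iff_norm] at hz
    exact (hdiff z (norm_pos_iff.1 (hz ▸ hs)) (hz ▸ hsr)).continuousAt.continuousWithinAt
  set κ : ℂ := (2 * π * I : ℂ)⁻¹ with hκ
  set p : A := κ • ∮ z in C(0, ρ), R z with hp
  -- This Cauchy transform supplies both inverses: `-K 0` inverts `a` modulo `p`, and `K w` with
  -- `‖w‖ > ρ` inverts `a - w` on the range of `p`.
  set K : ℂ → A := fun w => κ • ∮ z in C(0, ρ), (z - w)⁻¹ • R z with hK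
  have hKl : ∀ w : ℂ, ‖w‖ ≠ ρ →
      a * K w = p + w • K w - (κ * ∮ z in C(0, ρ), (z - w)⁻¹) • (1 : A) := fun w hw =>
    two_pi_I_inv_smul_circleIntegral_kernel hρ (hcont ρ hρ hρr) (ContinuousLinearMap.mul ℂ A a) 1
      (fun z hz => mul_resolvent_eq (hsph ρ hρ hρr z hz)) hw
  have hKr : ∀ w : ℂ, ‖w‖ ≠ ρ →
      K w * a = p + w • K w - (κ * ∮ z in C(0, ρ), (z - w)⁻¹) • (1 : A) := fun w hw =>
    two_pi_I_inv_smul_circleIntegral_kernel hρ (hcont ρ hρ hρr)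
      ((ContinuousLinearMap.mul ℂ A).flip a) 1
      (fun z hz => resolvent_mul_eq (hsph ρ hρ hρr z hz)) hw
  have hin : ∀ w : ℂ, ‖w‖ < ρ → κ * (∮ z in C(0, ρ), (z - w)⁻¹) = 1 := by
    intro w hw
    rw [circleIntegral.integral_sub_inv_of_mem_ball (by simpa using hw), hκ,
      inv_mul_cancel₀ Complex.two_pi_I_ne_zero]
  have hout : ∀ w : ℂ, ρ < ‖w‖ → κ * (∮ z in C(0, ρ), (z - w)⁻¹) = 0 := by
    intro w hw
    rw [circleIntegral_sub_inv_eq_zero hρ hw, mul_zero]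
  have hg1 : a * K 0 = p - 1 := by
    have := hKl 0 (by simpa using hρ.ne)
    rwa [hin 0 (by simpa using hρ), zero_smul, add_zero, one_smul] at this
  have hg2 : K 0 * a = p - 1 := by
    have := hKr 0 (by simpa using hρ.ne)
    rwa [hin 0 (by simpa using hρ), zero_smul, add_zero, one_smul] at this
  have hcomm : a * p = p * a := by
    have h1 : p = 1 + a * K 0 := by rw [hg1]; abel
    have h2 : a * K 0 = K 0 * a := by rw [hg1, hg2]
    rw [h1, mul_add, add_mul, mul_one, one_mul]
    rw [mul_assoc a (K 0) a, ← h2]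
  have hRp : ∀ w : ℂ, w ≠ 0 → ‖w‖ < ρ → R w * p = R w - K w := by
    intro w hw0 hw
    have h1 := hKl w hw.ne
    rw [hin w hw, one_smul] at h1
    have h2 : R w * a = w • R w - 1 := resolvent_mul_eq (ha w hw0 (hw.trans hρr))
    have h3 : p = a * K w - w • K w + 1 := by rw [h1]; abel
    rw [h3, mul_add, mul_sub, ← mul_assoc, h2, mul_one, sub_mul, one_mul, smul_mul_assoc,
      mul_smul_comm w (R w) (K w)]
    abel
  have hKdiff : DifferentiableOn ℂ K (Metric.ball 0 ρ) :=
    differentiableOn_cauchy_integral hρ ((hcont ρ hρ hρr).circleIntegrable hρ.le)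
  -- Computing `p` on a smaller circle places the circle where `R w * p = R w - K w` and `K` is
  -- holomorphic inside it, so the `K` term integrates to zero.
  have hidem : p * p = p := by
    set σ : ℝ := ρ / 2 with hσdef
    have hσ : 0 < σ := by positivity
    have hσρ : σ < ρ := by linarith
    have hpσ : p = κ • ∮ z in C(0, σ), R z := by
      rw [hp, Complex.circleIntegral_eq_of_differentiable_on_annulus_off_countable hσ hσρ.le
        Set.countable_empty]
      · rintro z ⟨hz1, hz2⟩
        rw [mem_closedBall_zero_iff] at hz1
        rw [mem_ball_zero_iff, not_lt] at hz2
        exact (hdiff z (norm_pos_iff.1 (hσ.trans_le hz2))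
          (hz1.trans_lt hρr)).continuousAt.continuousWithinAt
      · rintro z ⟨⟨hz1, hz2⟩, -⟩
        rw [mem_ball_zero_iff] at hz1
        rw [mem_closedBall_zero_iff, not_le] at hz2
        exact hdiff z (norm_pos_iff.1 (hσ.trans hz2)) (hz1.trans hρr)
    have hRint : CircleIntegrable R 0 σ :=
      (hcont σ hσ (hσρ.trans hρr)).circleIntegrable hσ.le
    have hKcl : DifferentiableOn ℂ K (Metric.closedBall 0 σ) :=
      hKdiff.mono (Metric.closedBall_subset_ball hσρ)
    have hKint : CircleIntegrable K 0 σ :=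
      (hKcl.continuousOn.mono Metric.sphere_subset_closedBall).circleIntegrable hσ.le
    have hK0 : (∮ z in C(0, σ), K z) = 0 :=
      DiffContOnCl.circleIntegral_eq_zero hσ.le
        (DifferentiableOn.diffContOnCl (by rwa [closure_ball _ hσ.ne']))
    have hmul : (∮ z in C(0, σ), R z) * p = ∮ z in C(0, σ), R z * p := by
      have := ContinuousLinearMap.intervalIntegral_comp_comm
        ((ContinuousLinearMap.mul ℂ A).flip p) hRint.out
      unfold circleIntegral
      simpa using this.symm
    have hcongr : (∮ z in C(0, σ), R z * p) = ∮ z in C(0, σ), R z - K z := by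
      refine circleIntegral.integral_congr hσ.le fun z hz => ?_
      rw [mem_sphere_zero_iff_norm] at hz
      exact hRp z (norm_pos_iff.1 (hz ▸ hσ)) (hz ▸ hσρ)
    calc p * p = κ • ((∮ z in C(0, σ), R z) * p) := by
          nth_rewrite 1 [hpσ]
          rw [smul_mul_assoc]
      _ = p := by
          rw [hmul, hcongr, circleIntegral.integral_sub hRint hKint, hK0, sub_zero, ← hpσ]
  refine ⟨p, -K 0, hidem, hcomm, by rw [mul_neg, hg1, neg_sub], by rw [neg_mul, hg2, neg_sub],
    fun z hz0 => ?_⟩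
  rcases lt_or_ge ‖z‖ r with hz | hz
  · have hres := ha z hz0 hz
    have h1 : (a - z • 1) * R z = -1 := by
      rw [sub_mul, mul_resolvent_eq hres, smul_mul_assoc, one_mul]
      abel
    have h2 : R z * (a - z • 1) = -1 := by
      rw [mul_sub, resolvent_mul_eq hres, mul_smul_comm, mul_one]
      abel
    refine ⟨-(R z * p), ?_, ?_⟩
    · rw [mul_neg, ← mul_assoc, h1, neg_one_mul, neg_neg]
    · have hc : p * (a - z • 1) = (a - z • 1) * p := by
        rw [mul_sub, sub_mul, hcomm, mul_smul_comm, smul_mul_assoc z 1 p, one_mul, mul_one]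
      rw [neg_mul, mul_assoc, hc, ← mul_assoc, h2, neg_one_mul, neg_neg]
  · have hz' : ρ < ‖z‖ := hρr.trans_le hz
    have h1 := hKl z hz'.ne'
    have h2 := hKr z hz'.ne'
    rw [hout z hz', zero_smul, sub_zero] at h1 h2
    refine ⟨K z, ?_, ?_⟩
    · rw [sub_mul, h1, smul_mul_assoc, one_mul, add_sub_cancel_right]
    · rw [mul_sub, h2, mul_smul_comm, mul_one, add_sub_cancel_right]

end RieszProjection

/-! ### From an isolated spectral point to a generalized Kato decomposition -/

section GenDrazin

variable {X : Type*} [NormedAddCommGroup X] [NormedSpace ℂ X]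

theorem isSemiRegular_of_bijective {A : X →L[ℂ] X} (hA : Function.Bijective A) :
    IsSemiRegular A := by
  refine ⟨by rw [hA.2.range_eq]; exact isClosed_univ, fun x hx n => ?_⟩
  rw [(injective_iff_map_eq_zero A).1 hA.1 x hx]
  exact ⟨0, map_zero _⟩

theorem IsGenDrazinInvertible.isPseudoFredholm [CompleteSpace X] {T : X →L[ℂ] X}
    (hT : IsGenDrazinInvertible T) : IsPseudoFredholm T := by
  rw [isGenDrazinInvertible_iff_eventually, Metric.eventually_nhds_iff] at hT
  obtain ⟨r, hr, hrT⟩ := hT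
  obtain ⟨p, g, hidem, hcomm, hg1, hg2, hh⟩ := exists_riesz_projection T hr
    fun z hz0 hz => spectrum.notMem_iff.1 (hrT (by simpa using hz) hz0)
  have hTp : ∀ x, T (p x) = p (T x) := fun x => DFunLike.congr_fun hcomm x
  have hpp : ∀ x, p (p x) = p x := fun x => DFunLike.congr_fun hidem x
  have hTg : ∀ x, T (g x) = x - p x := fun x => DFunLike.congr_fun hg1 x
  have hgT : ∀ x, g (T x) = x - p x := fun x => DFunLike.congr_fun hg2 x
  have hM : ∀ x ∈ p.ker, T x ∈ p.ker := by
    intro x hx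
    rw [LinearMap.mem_ker, ContinuousLinearMap.coe_coe] at hx ⊢
    rw [← hTp, hx, map_zero]
  have hN : ∀ x ∈ p.range, T x ∈ p.range := by
    rintro _ ⟨x, rfl⟩
    exact ⟨T x, (hTp x).symm⟩
  have hNc : IsClosed (p.range : Set X) :=
    ContinuousLinearMap.IsIdempotentElem.isClosed_range hidem
  have hcompl : IsCompl p.ker p.range :=
    (LinearMap.IsIdempotentElem.isCompl
      (ContinuousLinearMap.IsIdempotentElem.toLinearMap hidem)).symm
  have hNp : ∀ x ∈ p.range, p x = x := by
    rintro _ ⟨x, rfl⟩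
    exact hpp x
  refine ⟨p.ker, p.range, hM, hN, p.isClosed_ker, hNc, hcompl, isSemiRegular_of_bijective ⟨?_, ?_⟩,
    ?_⟩
  · rw [injective_iff_map_eq_zero]
    rintro ⟨x, hx⟩ hTx
    have hTx' : T x = 0 := congrArg Subtype.val hTx
    have hpx : p x = 0 := hx
    have := hgT x
    rw [hTx', hpx, map_zero, sub_zero] at this
    exact Subtype.ext this.symm
  · rintro ⟨x, hx⟩
    have hpx : p x = 0 := hx
    -- Subtracting `p (g x)` puts the preimage in `ker p` without checking that `g` preserves it;
    -- `T` sends the correction to `p (T (g x)) = 0`.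
    refine ⟨⟨g x - p (g x), ?_⟩, Subtype.ext ?_⟩
    · rw [LinearMap.mem_ker, ContinuousLinearMap.coe_coe, map_sub, hpp, sub_self]
    · change T (g x - p (g x)) = x
      rw [map_sub, hTp, hTg, hpx, sub_zero, hpx, sub_zero]
  · have := hNc.completeSpace_coe
    rw [isQuasinilpotent_iff]
    intro z hz
    by_contra hz0
    obtain ⟨h, hh1, hh2⟩ := hh z hz0
    have hh1' : ∀ x, T (h x) - z • h x = p x := fun x => DFunLike.congr_fun hh1 x
    have hh2' : ∀ x, h (T x - z • x) = p x := fun x => DFunLike.congr_fun hh2 x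
    refine (notMem_spectrum_iff_bijective _ z).2 ⟨?_, ?_⟩ hz
    · rw [injective_iff_map_eq_zero]
      intro x hx
      have hx' := congrArg Subtype.val hx
      rw [coe_restrict_sub_smul_id_apply] at hx'
      have := hh2' x
      rw [hx', ZeroMemClass.coe_zero, map_zero, hNp x x.2] at this
      exact Subtype.ext this.symm
    · rintro ⟨x, hx⟩
      refine ⟨⟨p (h x), h x, rfl⟩, Subtype.ext ?_⟩
      rw [coe_restrict_sub_smul_id_apply]
      change T (p (h x)) - z • p (h x) = x
      rw [hTp, ← map_smul, ← map_sub, hh1', hpp, hNp x hx]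

theorem gDSpectrum_eq_gKSpectrum_of_hasSVEP [CompleteSpace X] {T : X →L[ℂ] X} (hT : HasSVEP T)
    (hT' : HasSVEP (adj T)) : gDSpectrum T = gKSpectrum T := by
  ext z
  refine not_congr ⟨fun h => h.isPseudoFredholm, fun h => h.isGenDrazinInvertible
    (hT.sub_smul_id z) ?_⟩
  rw [adj_sub_smul_id]
  exact hT'.sub_smul_id z

end GenDrazin

end BanachOp

theorem mainTheorem8 {X : Type*} [NormedAddCommGroup X] [NormedSpace ℂ X] [CompleteSpace X]
    (T : X →L[ℂ] X) :
    (BanachOp.HasSVEP T → BanachOp.HasSVEP (BanachOp.adj T) →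
      BanachOp.gDSpectrum T = BanachOp.gKSpectrum T) ∧
    (BanachOp.IsDecomposable T → BanachOp.gDSpectrum T = BanachOp.gKSpectrum T) :=
  ⟨BanachOp.gDSpectrum_eq_gKSpectrum_of_hasSVEP,
    fun h => BanachOp.gDSpectrum_eq_gKSpectrum_of_hasSVEP h.hasSVEP h.hasSVEP_adj⟩
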